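/- **Setting.** All systems are finite-dimensional, $|X|$ denotes the dimension of $X$, and $\log$ is to base 2. Let $X_1,\dots,X_{\mathsf f}$ be nonzero quantum systems (the message systems). An $\mathsf r$-round one-server QPIR protocol $\Phi$ in the blind setting is given by unitary maps $\mathcal D^{(0)},\dots,\mathcal D^{(\mathsf r)}$ (user) and $\mathcal E^{(1)},\dots,\mathcal E^{(\mathsf r)}$ (server), which do not depend on the message states, as follows. The server holds $S^{(0)}=X_1\otimes\cdots\otimes X_{\mathsf f}$, in the state $\rho_{[\mathsf f]}=\rho_1\otimes\cdots\otimes\rho_{\mathsf f}$ with arbitrary message states $\rho_\ell$ on $X_\ell$, together with a (possibly trivial) local register in a fixed pure state $|0\rangle$, which is counted as part of $S^{(0)}$. For target index $k\in\{1,\dots,\mathsf f\}$ the user prepares $|k\rangle\otimes|0\rangle\in A^{(0)}\otimes T^{(0)}$, where the vectors $|k\rangle$ are orthonormal. In round $i=1,\dots,\mathsf r$ the user applies $\mathcal D^{(i-1)}$ from $A^{(i-1)}\otimes T^{(i-1)}$ to $Q^{(i)}\otimes T^{(i)}$ and sends $Q^{(i)}$ to the server; the server applies $\mathcal E^{(i)}$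 from $Q^{(i)}\otimes S^{(i-1)}$ to $A^{(i)}\otimes S^{(i)}$ and sends $A^{(i)}$ to the user. Finally the user applies $\mathcal D^{(\mathsf r)}$ from $A^{(\mathsf r)}\otimes T^{(\mathsf r)}$ to $Y\otimes E$ and outputs $Y$, in which each $X_k$ is identified with a subspace through a fixed isometry (the identity if $Y=X_k$). Let $\Gamma_{\Phi,k}$ be the resulting channel from $X_1\otimes\cdots\otimes X_{\mathsf f}$ to $Y$ (with $S^{(\mathsf r)}$ and $E$ traced out). The protocol has to satisfy: * *Correctness*: for every $k$, all message states $\rho_1,\dots,\rho_{\mathsf f}$ and every purification $|\psi_k\rangle$ of $\rho_k$ with a reference system $R_k$, $$(\Gamma_{\Phi,k}\otimes \mathrm{id}_{R_k})\Bigl(\bigotimes_{j\ne k}\rho_j\otimes|\psi_k\rangle\langle\psi_k|\Bigr)=|\psi_k\rangle\langle\psi_k|.$$ * *User secrecy*: for all message states and every round $i\in\{1,\dots,\mathsf r\}$, the state on $S^{(i-1)}\otimes Q^{(i)}$ does not depend on the target index $k$. **Theorem.** For every number of rounds $\mathsf r$ and every such protocol $\Phi$, the communication complexity, that is, the total size of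 all queries and answers, satisfies $$\sum_{i=1}^{\mathsf r}\bigl(\log|Q^{(i)}|+\log|A^{(i)}|\bigr)\;\ge\;\sum_{\ell=1}^{\mathsf f}\log|X_\ell| .$$ -/

import Mathlib

open scoped Kronecker Matrix ComplexOrder

noncomputable section

namespace QPIR

/-! Quantum systems are finite-dimensional and are described by matrices in a fixed orthonormal
(computational) basis: a system of dimension `n` has basis `Fin n`, a tensor product of systems
has the product of the bases. -/

/-- A density matrix: positive semidefinite with trace one. -/
def IsState {n : Type*} [Fintype n] (ρ : Matrix n n ℂ) : Prop :=
  ρ.PosSemidef ∧ ρ.trace = 1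

/-- A unitary map from the space with basis `n` onto the space with basis `m`. -/
def IsUnitaryMap {m n : Type*} [Fintype m] [Fintype n] [DecidableEq m] [DecidableEq n]
    (U : Matrix m n ℂ) : Prop :=
  Uᴴ * U = 1 ∧ U * Uᴴ = 1

/-- The operator `|ψ⟩⟨ψ|`. -/
def ketbra {n : Type*} (ψ : n → ℂ) : Matrix n n ℂ :=
  Matrix.of fun x y => ψ x * star (ψ y)

/-- Partial trace over the second tensor factor. -/
def traceRight {m n : Type*} [Fintype n] (M : Matrix (m × n) (m × n) ℂ) : Matrix m m ℂ :=
  Matrix.of fun x y => ∑ j, M (x, j) (y, j)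

/-- Partial trace over the first tensor factor. -/
def traceLeft {m n : Type*} [Fintype m] (M : Matrix (m × n) (m × n) ℂ) : Matrix n n ℂ :=
  Matrix.of fun x y => ∑ j, M (j, x) (j, y)

/-- The vector `ψ` of `X ⊗ R` is a purification of the state `ρ` of `X`. -/
def IsPurification {n m : Type*} [Fintype m] (ψ : n × m → ℂ) (ρ : Matrix n n ℂ) : Prop :=
  traceRight (ketbra ψ) = ρ

/-- The action of `Γ ⊗ id_R` for a linear map `Γ` on matrices: `Γ` is applied to each block
`⟨r| σ |r'⟩` of `σ`. -/
def tensorId {n m R : Type*} (Γ : Matrix n n ℂ → Matrix m m ℂ)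
    (σ : Matrix (n × R) (n × R) ℂ) : Matrix (m × R) (m × R) ℂ :=
  Matrix.of fun y y' => Γ (Matrix.of fun x x' => σ (x, y.2) (x', y'.2)) y.1 y'.1

/-- The basis of `X_1 ⊗ ⋯ ⊗ X_f`, where `X_ℓ` has dimension `d ℓ`. -/
abbrev MsgBasis {f : ℕ} (d : Fin f → ℕ) : Type := (ℓ : Fin f) → Fin (d ℓ)

/-- The product state `ρ_1 ⊗ ⋯ ⊗ ρ_f`. -/
def productState {f : ℕ} {d : Fin f → ℕ}
    (ρ : (ℓ : Fin f) → Matrix (Fin (d ℓ)) (Fin (d ℓ)) ℂ) :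
    Matrix (MsgBasis d) (MsgBasis d) ℂ :=
  Matrix.of fun x y => ∏ ℓ, ρ ℓ (x ℓ) (y ℓ)

/-- The state on `X_1 ⊗ ⋯ ⊗ X_f ⊗ R_k` in which message `k` and its reference `R_k` are in the
pure state `ψ` and the other messages are in the states `ρ_j`, `j ≠ k`. -/
def purifiedInput {f : ℕ} {d : Fin f → ℕ}
    (ρ : (ℓ : Fin f) → Matrix (Fin (d ℓ)) (Fin (d ℓ)) ℂ) (k : Fin f) {m : ℕ}
    (ψ : Fin (d k) × Fin m → ℂ) :
    Matrix (MsgBasis d × Fin m) (MsgBasis d × Fin m) ℂ :=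
  Matrix.of fun p q => (∏ j ∈ Finset.univ.erase k, ρ j (p.1 j) (q.1 j)) *
    ketbra ψ (p.1 k, p.2) (q.1 k, q.2)

/-- The data of an `r`-round one-server protocol in the blind setting, for `f` messages of
dimensions `d ℓ`. Only the entries of the sequences that concern the rounds `1, …, r` are used. -/
structure Protocol {f : ℕ} (d : Fin f → ℕ) (r : ℕ) where
  /-- `dA i = |A^(i)|`, the answer systems for `i ≥ 1`; `A^(0)` is the user's index register. -/
  dA : ℕ → ℕ
  /-- `dT i = |T^(i)|`, the user's local systems. -/
  dT : ℕ → ℕ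
  /-- `dQ i = |Q^(i)|`, the query systems, `i ≥ 1`. -/
  dQ : ℕ → ℕ
  /-- `dS i = |S^(i)|`, the server's systems. -/
  dS : ℕ → ℕ
  /-- The dimension of the server's local register (`1` if there is none). -/
  dL : ℕ
  /-- `|Y|`, the output system. -/
  dY : ℕ
  /-- `|E|`, the system that the user discards. -/
  dE : ℕ
  /-- The index `k` is encoded in the basis vector `ket k` of `A^(0)`. -/
  ket : Fin f ↪ Fin (dA 0)
  /-- The initial basis vector of `T^(0)`. -/
  zeroT : Fin (dT 0)
  /-- The initial basis vector of the server's local register. -/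
  zeroL : Fin dL
  /-- `S^(0)` is `X_1 ⊗ ⋯ ⊗ X_f` together with the server's local register. -/
  basisS : MsgBasis d × Fin dL ≃ Fin (dS 0)
  /-- `D i` is the user's operation `A^(i) ⊗ T^(i) → Q^(i+1) ⊗ T^(i+1)`, for `i < r`. -/
  D : (i : ℕ) → Matrix (Fin (dQ (i + 1)) × Fin (dT (i + 1))) (Fin (dA i) × Fin (dT i)) ℂ
  /-- `E i` is the server's operation `S^(i) ⊗ Q^(i+1) → S^(i+1) ⊗ A^(i+1)` of round `i + 1`,
  for `i < r`. -/
  E : (i : ℕ) → Matrix (Fin (dS (i + 1)) × Fin (dA (i + 1))) (Fin (dS i) × Fin (dQ (i + 1))) ℂ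
  /-- The user's final operation `A^(r) ⊗ T^(r) → Y ⊗ E`. -/
  Dfinal : Matrix (Fin dY × Fin dE) (Fin (dA r) × Fin (dT r)) ℂ
  /-- The identification of `X_k` with a subspace of the output system (if all messages have the
  same dimension and `Y = X_k`, the identity). -/
  emb : (k : Fin f) → Matrix (Fin dY) (Fin (d k)) ℂ
  D_unitary : ∀ i < r, IsUnitaryMap (D i)
  E_unitary : ∀ i < r, IsUnitaryMap (E i)
  Dfinal_unitary : IsUnitaryMap Dfinal
  emb_isometry : ∀ k, (emb k)ᴴ * emb k = 1

namespace Protocol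

variable {f : ℕ} {d : Fin f → ℕ} {r : ℕ} (Φ : Protocol d r)

/-- The initial isometry `|x⟩ ↦ |x⟩|0⟩ ⊗ |k⟩|0⟩` from `X_1 ⊗ ⋯ ⊗ X_f` into
`S^(0) ⊗ (A^(0) ⊗ T^(0))` when the target index is `k`. -/
def initial (k : Fin f) :
    Matrix (Fin (Φ.dS 0) × (Fin (Φ.dA 0) × Fin (Φ.dT 0))) (MsgBasis d) ℂ :=
  Matrix.of fun p x => if p = (Φ.basisS (x, Φ.zeroL), (Φ.ket k, Φ.zeroT)) then 1 else 0

/-- The user applies `D^(i)`:  from `S^(i) ⊗ (A^(i) ⊗ T^(i))` to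
`(S^(i) ⊗ Q^(i+1)) ⊗ T^(i+1)`. -/
def userStep (i : ℕ) :
    Matrix ((Fin (Φ.dS i) × Fin (Φ.dQ (i + 1))) × Fin (Φ.dT (i + 1)))
      (Fin (Φ.dS i) × (Fin (Φ.dA i) × Fin (Φ.dT i))) ℂ :=
  ((1 : Matrix (Fin (Φ.dS i)) (Fin (Φ.dS i)) ℂ) ⊗ₖ Φ.D i).submatrix
    (Equiv.prodAssoc _ _ _) id

/-- The server applies its operation of round `i + 1`: from `(S^(i) ⊗ Q^(i+1)) ⊗ T^(i+1)` to
`S^(i+1) ⊗ (A^(i+1) ⊗ T^(i+1))`. -/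
def serverStep (i : ℕ) :
    Matrix (Fin (Φ.dS (i + 1)) × (Fin (Φ.dA (i + 1)) × Fin (Φ.dT (i + 1))))
      ((Fin (Φ.dS i) × Fin (Φ.dQ (i + 1))) × Fin (Φ.dT (i + 1))) ℂ :=
  (Φ.E i ⊗ₖ (1 : Matrix (Fin (Φ.dT (i + 1))) (Fin (Φ.dT (i + 1))) ℂ)).submatrix
    (Equiv.prodAssoc _ _ _).symm id

/-- The operator from `X_1 ⊗ ⋯ ⊗ X_f` to `S^(i) ⊗ (A^(i) ⊗ T^(i))` that describes the protocol
up to the answer of round `i`, for target index `k`. -/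
def afterAnswer (k : Fin f) :
    (i : ℕ) → Matrix (Fin (Φ.dS i) × (Fin (Φ.dA i) × Fin (Φ.dT i))) (MsgBasis d) ℂ
  | 0 => Φ.initial k
  | i + 1 => Φ.serverStep i * (Φ.userStep i * afterAnswer k i)

/-- The operator from `X_1 ⊗ ⋯ ⊗ X_f` to `(S^(i) ⊗ Q^(i+1)) ⊗ T^(i+1)` that describes the
protocol up to the query of round `i + 1`, for target index `k`. -/
def afterQuery (k : Fin f) (i : ℕ) :
    Matrix ((Fin (Φ.dS i) × Fin (Φ.dQ (i + 1))) × Fin (Φ.dT (i + 1))) (MsgBasis d) ℂ :=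
  Φ.userStep i * Φ.afterAnswer k i

/-- The operator from `X_1 ⊗ ⋯ ⊗ X_f` to `S^(r) ⊗ (Y ⊗ E)` that describes the whole protocol,
for target index `k`. -/
def final (k : Fin f) :
    Matrix (Fin (Φ.dS r) × (Fin Φ.dY × Fin Φ.dE)) (MsgBasis d) ℂ :=
  ((1 : Matrix (Fin (Φ.dS r)) (Fin (Φ.dS r)) ℂ) ⊗ₖ Φ.Dfinal) * Φ.afterAnswer k r

/-- The channel from `X_1 ⊗ ⋯ ⊗ X_f` to `Y` implemented by the protocol for target index `k`. -/
def channel (k : Fin f) (ρ : Matrix (MsgBasis d) (MsgBasis d) ℂ) :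
    Matrix (Fin Φ.dY) (Fin Φ.dY) ℂ :=
  traceRight (traceLeft (Φ.final k * ρ * (Φ.final k)ᴴ))

/-- The state on `S^(i) ⊗ Q^(i+1)`, i.e. what the server holds on receiving the query of round
`i + 1`, for target index `k`. -/
def serverState (k : Fin f) (i : ℕ) (ρ : Matrix (MsgBasis d) (MsgBasis d) ℂ) :
    Matrix (Fin (Φ.dS i) × Fin (Φ.dQ (i + 1))) (Fin (Φ.dS i) × Fin (Φ.dQ (i + 1))) ℂ :=
  traceRight (Φ.afterQuery k i * ρ * (Φ.afterQuery k i)ᴴ)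

/-- Correctness: for every target index `k`, all message states and every purification `ψ` of
`ρ_k`, the protocol maps `|ψ⟩⟨ψ|` on `X_k ⊗ R_k` to the same state on `Y ⊗ R_k`. -/
def Correct : Prop :=
  ∀ (k : Fin f) (ρ : (ℓ : Fin f) → Matrix (Fin (d ℓ)) (Fin (d ℓ)) ℂ), (∀ ℓ, IsState (ρ ℓ)) →
    ∀ (m : ℕ) (ψ : Fin (d k) × Fin m → ℂ), IsPurification ψ (ρ k) →
      tensorId (Φ.channel k) (purifiedInput ρ k ψ) =
        ketbra ((Φ.emb k ⊗ₖ (1 : Matrix (Fin m) (Fin m) ℂ)) *ᵥ ψ)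

/-- User secrecy: in every round the state of the server's system together with the query does
not depend on the target index, whatever the message states are. -/
def Secret : Prop :=
  ∀ ρ : (ℓ : Fin f) → Matrix (Fin (d ℓ)) (Fin (d ℓ)) ℂ, (∀ ℓ, IsState (ρ ℓ)) →
    ∀ (k k' : Fin f), ∀ i < r,
      Φ.serverState k i (productState ρ) = Φ.serverState k' i (productState ρ)

/-- The communication complexity `∑_{i=1}^r (log |Q^(i)| + log |A^(i)|)`, in qubits. -/
def cost : ℝ :=
  ∑ i ∈ Finset.Icc 1 r, (Real.logb 2 (Φ.dQ i) + Real.logb 2 (Φ.dA i))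

end Protocol

end QPIR

end

/-! The bound already holds for the answers alone: the product of the `|A^(i)|` is at least the
product of the `|X_ℓ|`. Write the protocol up to some point as an isometry from the messages `X` to
server ⊗ user, with blocks `B s` for the basis vectors `s` of the server. Two facts about these
blocks collide.

Growth: `∑ s, |B s⟩⟩⟨⟨B s|` is the unnormalised Choi operator of the user's part, and it stays below
`τ ⊗ 1` (`IsDominated`) for some `τ` whose trace measures how much the user can have learnt.
Initially `τ` is the user's pure state. User operations, queries and server operations preserve the
trace of `τ`; receiving `A` multiplies it by `|A| ^ 2`, as in superdense coding. So `τ.trace = ∏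
|A^(j)| ^ 2` at the end (`exists_isDominated_answerBlock`).

Decoupling: the products `(B s)ᴴ * B t` encode the joint state of the server and a reference for the
messages. By secrecy they do not depend on the target index at the end either. Correctness for index
`ℓ` makes them trivial in message `ℓ`; applied to all `ℓ`, this makes each product a multiple of the
identity (`answerBlock_mul_eq_smul`). The user then holds all the messages coherently, and testing
the domination on the blocks themselves gives `|X| ^ 2 ≤ τ.trace` (`IsDominated.card_sq_le`). -/

noncomputable section

namespace QPIR

/-! ### Bounds on Choi operators by `τ ⊗ 1` -/

section Domination

variable {S U X A T Q : Type*} [Fintype S] [Fintype U] [Fintype X] [Fintype A] [Fintype T]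
  [Fintype Q]

/-- The operator `∑ s, |B s⟩⟩⟨⟨B s|` of a family of matrices is bounded by `τ ⊗ 1`. -/
def IsDominated (B : S → Matrix U X ℂ) (τ : Matrix U U ℂ) : Prop :=
  τ.PosSemidef ∧ ∀ Z : Matrix U X ℂ,
    ∑ s, ‖(Zᴴ * B s).trace‖ ^ 2 ≤ (Zᴴ * τ * Z).trace.re

theorem IsDominated.conj {B : S → Matrix U X ℂ} {τ : Matrix U U ℂ} (h : IsDominated B τ)
    (D : Matrix T U ℂ) : IsDominated (fun s => D * B s) (D * τ * Dᴴ) := by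
  refine ⟨h.1.mul_mul_conjTranspose_same D, fun Z => ?_⟩
  have := h.2 (Dᴴ * Z)
  simpa only [Matrix.conjTranspose_mul, Matrix.conjTranspose_conjTranspose, Matrix.mul_assoc]
    using this

theorem trace_traceLeft (M : Matrix (Q × T) (Q × T) ℂ) : (traceLeft M).trace = M.trace := by
  simp only [Matrix.trace, traceLeft, Matrix.diag_apply, Matrix.of_apply]
  rw [Finset.sum_comm, Fintype.sum_prod_type]

theorem posSemidef_traceLeft {T : Type*} {M : Matrix (Q × T) (Q × T) ℂ} (h : M.PosSemidef) :
    (traceLeft M).PosSemidef := by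
  have : traceLeft M = ∑ q, M.submatrix (fun t => (q, t)) (fun t => (q, t)) := by
    ext t t'
    simp [traceLeft, Matrix.sum_apply]
  rw [this]
  exact Matrix.posSemidef_sum _ fun q _ => h.submatrix _

/-- This is the sending of `Q` to the server: the index of `Q` joins the traced-out family. The
bound for each `q` is the old one tested on `Z` placed in block `q`. -/
theorem IsDominated.slice {B : S → Matrix (Q × T) X ℂ} {τ : Matrix (Q × T) (Q × T) ℂ}
    (h : IsDominated B τ) :
    IsDominated (fun p : S × Q => (B p.1).submatrix (fun t => (p.2, t)) id) (traceLeft τ) := by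
  classical
  refine ⟨posSemidef_traceLeft h.1, fun Z => ?_⟩
  let Y : Q → Matrix (Q × T) X ℂ := fun q => Matrix.of fun p x => if p.1 = q then Z p.2 x else 0
  have hY : ∀ q, ∀ M : Matrix (Q × T) X ℂ,
      (Y q)ᴴ * M = Zᴴ * M.submatrix (fun t => (q, t)) id := by
    intro q M
    ext x x'
    simp [Y, Matrix.mul_apply, Fintype.sum_prod_type, apply_ite star, ite_mul,
      Finset.sum_ite_irrel]
  have hτ : (Zᴴ * traceLeft τ * Z).trace = ∑ q, ((Y q)ᴴ * τ * Y q).trace := by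
    rw [← Matrix.trace_sum]
    congr 1
    simp_rw [Matrix.mul_assoc, hY]
    rw [← Matrix.mul_sum]
    congr 1
    ext t x
    simp only [Matrix.mul_apply, Matrix.sum_apply, Matrix.submatrix_apply, id, traceLeft,
      Matrix.of_apply, Finset.sum_mul, Y, Fintype.sum_prod_type, mul_ite, mul_zero]
    rw [Finset.sum_comm]
    refine Finset.sum_congr rfl fun q _ => ?_
    simp [Finset.sum_ite_irrel]
  rw [hτ, Complex.re_sum, Fintype.sum_prod_type_right]
  refine Finset.sum_le_sum fun q _ => ?_
  simpa only [hY] using h.2 (Y q)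

theorem sum_norm_sq_of_isometry {P : Type*} [Fintype P] [DecidableEq S] {E : Matrix P S ℂ}
    (hE : Eᴴ * E = 1) (v : S → ℂ) :
    ∑ p, ‖∑ s, E p s * v s‖ ^ 2 = ∑ s, ‖v s‖ ^ 2 := by
  have key : ∀ {J : Type _} [Fintype J] (w : J → ℂ), ((∑ j, ‖w j‖ ^ 2 : ℝ) : ℂ) = star w ⬝ᵥ w := by
    intro J _ w
    simp only [dotProduct, Pi.star_apply, Complex.ofReal_sum, Complex.ofReal_pow]
    refine Finset.sum_congr rfl fun j _ => ?_
    rw [Complex.star_def, Complex.conj_mul']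
  apply Complex.ofReal_injective
  have h1 := key (fun s => v s)
  have h2 : ((∑ p, ‖∑ s, E p s * v s‖ ^ 2 : ℝ) : ℂ) = star (E *ᵥ v) ⬝ᵥ (E *ᵥ v) := by
    simp only [dotProduct, Pi.star_apply, Complex.ofReal_sum, Complex.ofReal_pow, Matrix.mulVec]
    refine Finset.sum_congr rfl fun j _ => ?_
    rw [Complex.star_def, Complex.conj_mul']
  rw [h1, h2, Matrix.star_mulVec, ← Matrix.dotProduct_mulVec, Matrix.mulVec_mulVec, hE,
    Matrix.one_mulVec]

/-- An isometry on the server's side does not change the state left after tracing the server out, so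
the same `τ` serves. -/
theorem IsDominated.mix {P : Type*} [Fintype P] [DecidableEq S] {B : S → Matrix U X ℂ}
    {τ : Matrix U U ℂ} (h : IsDominated B τ) {E : Matrix P S ℂ} (hE : Eᴴ * E = 1) :
    IsDominated (fun p => ∑ s, E p s • B s) τ := by
  refine ⟨h.1, fun Z => ?_⟩
  refine le_of_eq_of_le ?_ (h.2 Z)
  rw [← sum_norm_sq_of_isometry hE]
  simp [Matrix.mul_sum, Matrix.trace_sum]

/-- This is the receipt of the answer `A`, the only step that enlarges the trace. One factor `|A|`
comes from Cauchy–Schwarz over the `|A|` blocks, the other from the trace of `1` on `A`. -/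
theorem IsDominated.stack [DecidableEq A] {B : S × A → Matrix T X ℂ} {τ : Matrix T T ℂ}
    (h : IsDominated B τ) :
    IsDominated (fun s => (Matrix.of fun p x => B (s, p.1) p.2 x : Matrix (A × T) X ℂ))
      ((Fintype.card A : ℂ) • ((1 : Matrix A A ℂ) ⊗ₖ τ)) := by
  refine ⟨(Matrix.PosSemidef.one.kronecker h.1).smul (Nat.cast_nonneg _), fun Z => ?_⟩
  let Y : A → Matrix T X ℂ := fun a => Z.submatrix (fun t => (a, t)) id
  have h1 : ∀ M : Matrix (A × T) X ℂ, (Zᴴ * M).trace =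
      ∑ a, ((Y a)ᴴ * M.submatrix (fun t => (a, t)) id).trace := by
    intro M
    rw [← Matrix.trace_sum]
    congr 1
    ext x x'
    simp [Y, Matrix.mul_apply, Fintype.sum_prod_type, Matrix.sum_apply]
  have h2 : (Zᴴ * ((Fintype.card A : ℂ) • ((1 : Matrix A A ℂ) ⊗ₖ τ)) * Z).trace.re =
      Fintype.card A * ∑ a, ((Y a)ᴴ * τ * Y a).trace.re := by
    rw [Matrix.mul_smul, Matrix.smul_mul, Matrix.trace_smul, Matrix.mul_assoc, h1,
      ← Complex.re_sum]
    have : ∀ a, ((1 : Matrix A A ℂ) ⊗ₖ τ * Z).submatrix (fun t => (a, t)) id = τ * Y a := by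
      intro a
      ext t x
      simp [Y, Matrix.mul_apply, Fintype.sum_prod_type, Matrix.one_apply, Finset.sum_ite_irrel]
    simp_rw [this, ← Matrix.mul_assoc]
    rw [smul_eq_mul, ← Complex.ofReal_natCast, Complex.re_ofReal_mul]
  rw [h2]
  calc ∑ s, ‖(Zᴴ * (Matrix.of fun p x => B (s, p.1) p.2 x : Matrix (A × T) X ℂ)).trace‖ ^ 2
      = ∑ s, ‖∑ a, ((Y a)ᴴ * B (s, a)).trace‖ ^ 2 := by
        refine Finset.sum_congr rfl fun s _ => ?_
        rw [h1]
        rfl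
    _ ≤ ∑ s, Fintype.card A * ∑ a, ‖((Y a)ᴴ * B (s, a)).trace‖ ^ 2 := by
        refine Finset.sum_le_sum fun s _ => ?_
        refine le_trans (pow_le_pow_left₀ (norm_nonneg _) (norm_sum_le _ _) 2) ?_
        exact sq_sum_le_card_mul_sum_sq
    _ = Fintype.card A * ∑ a, ∑ s, ‖((Y a)ᴴ * B (s, a)).trace‖ ^ 2 := by
        rw [← Finset.mul_sum, Finset.sum_comm]
    _ ≤ Fintype.card A * ∑ a, ((Y a)ᴴ * τ * Y a).trace.re := by
        gcongr with a
        -- The domination tested on `Y a` controls the sum over all pairs `(s, a')`; only the terms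
        -- with `a' = a` are kept.
        refine le_trans ?_ (h.2 (Y a))
        rw [Fintype.sum_prod_type]
        refine Finset.sum_le_sum fun s _ => ?_
        exact Finset.single_le_sum (f := fun a' => ‖((Y a)ᴴ * B (s, a')).trace‖ ^ 2)
          (fun _ _ => by positivity) (Finset.mem_univ a)

/-- Compressing a positive semidefinite matrix by an orthogonal projection does not increase
the trace. -/
theorem trace_mul_re_le_of_projection {τ P : Matrix U U ℂ} (hτ : τ.PosSemidef)
    (hP : Pᴴ = P) (hPP : P * P = P) : (P * τ).trace.re ≤ τ.trace.re := by
  classical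
  have h := (hτ.conjTranspose_mul_mul_same (1 - P)).trace_nonneg
  have h2 : ((1 - P)ᴴ * τ * (1 - P)).trace = τ.trace - (P * τ).trace := by
    rw [Matrix.trace_mul_comm, ← Matrix.mul_assoc, Matrix.conjTranspose_sub, hP,
      Matrix.conjTranspose_one]
    have : (1 - P) * (1 - P) = 1 - P := by
      simp [Matrix.mul_sub, Matrix.sub_mul, hPP]
    rw [this, Matrix.sub_mul, Matrix.trace_sub, Matrix.one_mul]
  rw [h2] at h
  have := (Complex.le_def.1 h).1
  simp at this
  linarith

/-- Testing the domination on `Z = B s` leaves a single term, `(l s * |X|) ^ 2`. Dividing by `l s`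
and summing gives `|X| ^ 2` on the left and `(P * τ).trace` on the right, where `P` projects onto
the sum of the mutually orthogonal ranges of the `B s`. -/
theorem IsDominated.card_sq_le_of_orthogonal [DecidableEq S] [DecidableEq X] [Nonempty X]
    {B : S → Matrix U X ℂ} {τ : Matrix U U ℂ} (h : IsDominated B τ) (l : S → ℝ)
    (hB : ∀ s t, (B s)ᴴ * B t = if s = t then (l s : ℂ) • 1 else 0) (hl : ∑ s, l s = 1) :
    (Fintype.card X : ℝ) ^ 2 ≤ τ.trace.re := by
  have hl0 : ∀ s, 0 ≤ l s := by
    intro s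
    obtain ⟨x⟩ := ‹Nonempty X›
    have h1 := (Matrix.posSemidef_conjTranspose_mul_self (B s)).diag_nonneg (i := x)
    rw [hB, if_pos rfl] at h1
    simpa using h1
  let P : Matrix U U ℂ := ∑ s, ((l s)⁻¹ : ℂ) • (B s * (B s)ᴴ)
  have hP : Pᴴ = P := by
    simp [P, Matrix.conjTranspose_sum]
  have hPP : P * P = P := by
    simp only [P, Matrix.sum_mul, Matrix.mul_sum, Matrix.smul_mul, Matrix.mul_smul]
    refine Finset.sum_congr rfl fun s _ => ?_
    rw [Finset.sum_eq_single s]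
    · rw [Matrix.mul_assoc, ← Matrix.mul_assoc (B s)ᴴ, hB, if_pos rfl]
      simp only [Matrix.smul_mul, Matrix.one_mul, Matrix.mul_smul, smul_smul]
      congr 1
      -- When `l s = 0` the convention `0⁻¹ = 0` removes the term from `P`, consistently with `B s =
      -- 0`.
      by_cases h0 : (l s : ℂ) = 0
      · simp [h0]
      · field_simp
    · intro t _ hts
      rw [Matrix.mul_assoc, ← Matrix.mul_assoc (B _)ᴴ, hB]
      simp [hts]
    · simp
  refine le_trans ?_ (trace_mul_re_le_of_projection h.1 hP hPP)
  have h3 : (P * τ).trace.re = ∑ s, (l s)⁻¹ * ((B s)ᴴ * τ * B s).trace.re := by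
    simp only [P, Matrix.sum_mul, Matrix.trace_sum, Complex.re_sum, Matrix.smul_mul,
      Matrix.trace_smul, smul_eq_mul]
    refine Finset.sum_congr rfl fun s _ => ?_
    rw [← Complex.ofReal_inv, Complex.re_ofReal_mul, Matrix.mul_assoc, Matrix.trace_mul_comm,
      Matrix.mul_assoc]
  rw [h3]
  calc (Fintype.card X : ℝ) ^ 2 = ∑ s, l s * (Fintype.card X : ℝ) ^ 2 := by
        rw [← Finset.sum_mul, hl, one_mul]
    _ ≤ _ := by
      refine Finset.sum_le_sum fun s _ => ?_
      have h4 := h.2 (B s)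
      rw [Finset.sum_eq_single s] at h4
      · rw [hB, if_pos rfl, Matrix.trace_smul, Matrix.trace_one] at h4
        simp only [smul_eq_mul, norm_mul, Complex.norm_real, Complex.norm_natCast,
          Real.norm_of_nonneg (hl0 s)] at h4
        refine le_trans (le_of_eq ?_) (mul_le_mul_of_nonneg_left h4 (inv_nonneg.2 (hl0 s)))
        by_cases h0 : l s = 0
        · simp [h0]
        · field_simp
      · intro t _ hts
        simp [hB, hts.symm]
      · simp

/-- `σ` is the server's reduced state. Passing to an eigenbasis of `σ` on the server's side keeps
the domination and reduces to the orthogonal case, with the eigenvalues as weights. -/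
theorem IsDominated.card_sq_le [DecidableEq S] [DecidableEq X] [Nonempty X]
    {B : S → Matrix U X ℂ} {τ : Matrix U U ℂ} (h : IsDominated B τ) (σ : Matrix S S ℂ)
    (hB : ∀ s t, (B s)ᴴ * B t = σ t s • 1) (hσ : σ.trace = 1) :
    (Fintype.card X : ℝ) ^ 2 ≤ τ.trace.re := by
  have hH : σ.IsHermitian := by
    ext s t
    obtain ⟨x⟩ := ‹Nonempty X›
    have h1 : σ s t • (1 : Matrix X X ℂ) = (σ t s • 1)ᴴ := by
      rw [← hB t s, ← hB s t, Matrix.conjTranspose_mul, Matrix.conjTranspose_conjTranspose]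
    simpa using (congrFun₂ h1 x x).symm
  let V : Matrix S S ℂ := hH.eigenvectorUnitary
  have hV : V * Vᴴ = 1 := Matrix.mem_unitaryGroup_iff.1 hH.eigenvectorUnitary.2
  have hV' : Vᴴ * V = 1 := Matrix.mem_unitaryGroup_iff'.1 hH.eigenvectorUnitary.2
  have hdiag : Vᴴ * σ * V = Matrix.diagonal (fun s => (hH.eigenvalues s : ℂ)) := by
    have := hH.spectral_theorem
    rw [Unitary.conjStarAlgAut_apply] at this
    have e : σ = V * Matrix.diagonal (fun s => (hH.eigenvalues s : ℂ)) * Vᴴ := this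
    conv_lhs => rw [e]
    rw [Matrix.mul_assoc, Matrix.mul_assoc, hV', Matrix.mul_one, ← Matrix.mul_assoc, hV',
      Matrix.one_mul]
  refine (h.mix (E := Vᴴ) (by simpa using hV)).card_sq_le_of_orthogonal hH.eigenvalues ?_ ?_
  · intro s t
    have h1 : (∑ p, Vᴴ s p • B p)ᴴ * (∑ p, Vᴴ t p • B p) = ((Vᴴ * σ * V) t s) • 1 := by
      have h2 : (Vᴴ * σ * V) t s = ∑ p, ∑ q, V p s * (Vᴴ t q * σ q p) := by
        simp only [Matrix.mul_apply, Finset.sum_mul]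
        exact Finset.sum_congr rfl fun p _ => Finset.sum_congr rfl fun q _ => mul_comm _ _
      rw [h2, Matrix.conjTranspose_sum, Matrix.sum_mul, Finset.sum_smul]
      refine Finset.sum_congr rfl fun p _ => ?_
      rw [Matrix.mul_sum, Finset.sum_smul]
      refine Finset.sum_congr rfl fun q _ => ?_
      rw [Matrix.conjTranspose_smul, Matrix.smul_mul, Matrix.mul_smul, hB, smul_smul, smul_smul,
        Matrix.conjTranspose_apply, star_star, mul_assoc]
    rw [h1, hdiag, Matrix.diagonal_apply]
    by_cases hst : s = t
    · subst hst; simp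
    · simp [hst, Ne.symm hst]
  · apply Complex.ofReal_injective
    have h2 : (Vᴴ * σ * V).trace = 1 := by
      rw [Matrix.trace_mul_comm, ← Matrix.mul_assoc, hV, Matrix.one_mul, hσ]
    rw [hdiag, Matrix.trace_diagonal] at h2
    simpa using h2

end Domination

/-! ### Product states span; sums of rank-one operators -/

section States

open scoped Matrix.Norms.L2Operator MatrixOrder in
-- Positive semidefinite matrices span, and each of them is zero or a multiple of a state.
theorem span_isState {n : Type*} [Fintype n] [DecidableEq n] :
    Submodule.span ℂ {ρ : Matrix n n ℂ | IsState ρ} = ⊤ := by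
  rw [eq_top_iff, ← CStarAlgebra.span_nonneg, Submodule.span_le]
  intro M hM
  have hM : M.PosSemidef := Matrix.nonneg_iff_posSemidef.1 hM
  by_cases h0 : M.trace = 0
  · rw [hM.trace_eq_zero_iff.1 h0]
    exact Submodule.zero_mem _
  · have : M = M.trace • (M.trace⁻¹ • M) := by rw [smul_smul, mul_inv_cancel₀ h0, one_smul]
    rw [this]
    refine Submodule.smul_mem _ _ (Submodule.subset_span ⟨hM.smul ?_, ?_⟩)
    · exact inv_nonneg.2 hM.trace_nonneg
    · rw [Matrix.trace_smul, smul_eq_mul, inv_mul_cancel₀ h0]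

variable {f : ℕ} {d : Fin f → ℕ}

/-- A linear functional on matrices is determined by its values on product states. -/
theorem eq_of_forall_productState {L L' : MsgBasis d → MsgBasis d → ℂ}
    (h : ∀ ρ : (ℓ : Fin f) → Matrix (Fin (d ℓ)) (Fin (d ℓ)) ℂ, (∀ ℓ, IsState (ρ ℓ)) →
      ∑ x, ∑ y, L x y * productState ρ x y = ∑ x, ∑ y, L' x y * productState ρ x y) :
    L = L' := by
  -- The pairing with a product state is multilinear in the factors, so agreement on states, which
  -- span each factor, extends to matrix units, and these recover the coefficients.
  let F : (MsgBasis d → MsgBasis d → ℂ) →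
      MultilinearMap ℂ (fun ℓ => Matrix (Fin (d ℓ)) (Fin (d ℓ)) ℂ) ℂ := fun L =>
    ∑ x, ∑ y, L x y • (MultilinearMap.mkPiAlgebra ℂ (Fin f) ℂ).compLinearMap
      (fun ℓ => Matrix.entryLinearMap ℂ ℂ (x ℓ) (y ℓ))
  have hF : ∀ L ρ, F L ρ = ∑ x, ∑ y, L x y * productState ρ x y := by
    intro L ρ
    simp [F, sum_apply, productState]
  have hFF : F L = F L' := by
    refine MultilinearMap.ext_of_span_eq_top
      (g := fun ℓ (ρ : {ρ : Matrix (Fin (d ℓ)) (Fin (d ℓ)) ℂ | IsState ρ}) => (ρ : Matrix _ _ ℂ))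
      (fun ℓ => by rw [Subtype.range_coe]; exact span_isState) fun ρ => ?_
    rw [hF, hF]
    exact h (fun ℓ => (ρ ℓ : Matrix (Fin (d ℓ)) (Fin (d ℓ)) ℂ)) fun ℓ => (ρ ℓ).2
  ext x y
  have key : ∀ L, F L (fun ℓ => Matrix.single (x ℓ) (y ℓ) 1) = L x y := by
    intro L
    have e : ∀ x' y', productState (fun ℓ => Matrix.single (x ℓ) (y ℓ) (1 : ℂ)) x' y' =
        if x = x' ∧ y = y' then 1 else 0 := by
      intro x' y'
      simp only [productState, Matrix.of_apply, Matrix.single_apply]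
      rw [Finset.prod_ite_zero]
      simp [funext_iff, forall_and]
    rw [hF, Finset.sum_eq_single x, Finset.sum_eq_single y]
    · simp [e]
    · intro b _ hb; simp [e, hb.symm]
    · simp
    · intro b _ hb; simp [e, hb.symm]
    · simp
  rw [← key L, ← key L', hFF]

/-- If a sum of rank-one operators `|v i⟩⟨v i|` equals `|w⟩⟨w|`, every `v i` is a multiple of
`w`. -/
theorem exists_smul_of_sum_ketbra {ι n : Type*} [Fintype ι] [Fintype n] {v : ι → n → ℂ}
    {w : n → ℂ} (h : ∑ i, ketbra (v i) = ketbra w) (i : ι) : ∃ c : ℂ, v i = c • w := by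
  have hq : ∀ u z : n → ℂ, star z ⬝ᵥ (ketbra u *ᵥ z) = ((‖star z ⬝ᵥ u‖ ^ 2 : ℝ) : ℂ) := by
    intro u z
    have : ketbra u *ᵥ z = (star u ⬝ᵥ z) • u := by
      ext x
      simp only [ketbra, Matrix.mulVec, dotProduct, Matrix.of_apply, Pi.smul_apply, smul_eq_mul,
        Finset.sum_mul, Pi.star_apply]
      exact Finset.sum_congr rfl fun y _ => by ring
    rw [this, dotProduct_smul, smul_eq_mul, Complex.ofReal_pow, ← Complex.conj_mul']
    congr 1
    simp only [dotProduct, map_sum, map_mul, Pi.star_apply]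
    exact Finset.sum_congr rfl fun y _ => by simp [mul_comm]
  -- For `z ⟂ w` the quadratic form at `z` is a vanishing sum of the nonnegative terms `‖⟨z, v j⟩‖ ^
  -- 2`.
  have horth : ∀ z : n → ℂ, star z ⬝ᵥ w = 0 → star z ⬝ᵥ v i = 0 := by
    intro z hz
    have h1 := congrArg (fun M => star z ⬝ᵥ (M *ᵥ z)) h
    simp only [Matrix.sum_mulVec, dotProduct_sum, hq, hz] at h1
    rw [← Complex.ofReal_sum] at h1
    have h2 := Complex.ofReal_injective h1
    have h3 := (Finset.sum_eq_zero_iff_of_nonneg (fun j _ => by positivity)).1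
      (h2.trans (by simp)) i (Finset.mem_univ i)
    simpa using h3
  by_cases hw : w = 0
  · refine ⟨0, ?_⟩
    have := horth (v i) (by simp [hw])
    rw [dotProduct_star_self_eq_zero] at this
    simp [this]
  · have hw' : star w ⬝ᵥ w ≠ 0 := by
      rwa [ne_eq, dotProduct_star_self_eq_zero]
    refine ⟨(star w ⬝ᵥ v i) / (star w ⬝ᵥ w), ?_⟩
    set c := (star w ⬝ᵥ v i) / (star w ⬝ᵥ w) with hc
    have h0 : star w ⬝ᵥ (v i - c • w) = 0 := by
      rw [dotProduct_sub, dotProduct_smul, smul_eq_mul, hc, div_mul_cancel₀ _ hw', sub_self]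
    have h1 : star (v i - c • w) ⬝ᵥ w = 0 := by
      rw [Matrix.star_dotProduct, h0, star_zero]
    have h2 : star (v i - c • w) ⬝ᵥ (v i - c • w) = 0 := by
      rw [dotProduct_sub, horth _ h1, dotProduct_smul, h1]; simp
    rw [dotProduct_star_self_eq_zero, sub_eq_zero] at h2
    exact h2

end States

/-! ### The protocol in blocks, and the growth of the user's information -/

namespace Protocol

variable {f : ℕ} {d : Fin f → ℕ} {r : ℕ} (Φ : Protocol d r)

/-- The block `⟨s| · ` of `afterAnswer` for a basis vector `s` of the server's system. -/
def answerBlock (k : Fin f) (i : ℕ) (s : Fin (Φ.dS i)) :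
    Matrix (Fin (Φ.dA i) × Fin (Φ.dT i)) (MsgBasis d) ℂ :=
  Matrix.of fun u x => Φ.afterAnswer k i (s, u) x

/-- The block of `afterQuery` for a basis vector of the server's system and the query. -/
def queryBlock (k : Fin f) (i : ℕ) (p : Fin (Φ.dS i) × Fin (Φ.dQ (i + 1))) :
    Matrix (Fin (Φ.dT (i + 1))) (MsgBasis d) ℂ :=
  Matrix.of fun t x => Φ.afterQuery k i (p, t) x

/-- The block of `final` for a basis vector of the server's system. -/
def finalBlock (k : Fin f) (s : Fin (Φ.dS r)) :
    Matrix (Fin Φ.dY × Fin Φ.dE) (MsgBasis d) ℂ :=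
  Matrix.of fun u x => Φ.final k (s, u) x

theorem queryBlock_eq (k : Fin f) (i : ℕ) :
    Φ.queryBlock k i = fun p =>
      (Φ.D i * Φ.answerBlock k i p.1).submatrix (fun t => (p.2, t)) id := by
  ext p t x
  simp [queryBlock, answerBlock, afterQuery, userStep, Matrix.mul_apply, Fintype.sum_prod_type,
    Matrix.one_apply, Finset.sum_ite_irrel]

theorem answerBlock_succ (k : Fin f) (i : ℕ) :
    Φ.answerBlock k (i + 1) = fun s => Matrix.of fun p x =>
      (∑ q, Φ.E i (s, p.1) q • Φ.queryBlock k i q) p.2 x := by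
  ext s p x
  have : Φ.afterAnswer k (i + 1) = Φ.serverStep i * Φ.afterQuery k i := rfl
  simp [answerBlock, queryBlock, this, serverStep, Matrix.mul_apply, Fintype.sum_prod_type,
    Matrix.one_apply, Matrix.sum_apply]

theorem finalBlock_eq (k : Fin f) (s : Fin (Φ.dS r)) :
    Φ.finalBlock k s = Φ.Dfinal * Φ.answerBlock k r s := by
  ext p x
  simp [finalBlock, answerBlock, final, Matrix.mul_apply, Fintype.sum_prod_type,
    Matrix.one_apply, Finset.sum_ite_irrel]

theorem answerBlock_zero_apply (k : Fin f) (s : Fin (Φ.dS 0))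
    (u : Fin (Φ.dA 0) × Fin (Φ.dT 0)) (x : MsgBasis d) :
    Φ.answerBlock k 0 s u x =
      if u = (Φ.ket k, Φ.zeroT) then (if s = Φ.basisS (x, Φ.zeroL) then 1 else 0) else 0 := by
  simp only [answerBlock, afterAnswer, initial, Matrix.of_apply, Prod.mk.injEq]
  rw [← ite_and]
  simp only [and_comm]

/-- Before the first round the user's fixed pure state is uncorrelated with the messages, which
gives trace one. -/
theorem isDominated_answerBlock_zero (k : Fin f) :
    IsDominated (Φ.answerBlock k 0) (Matrix.single (Φ.ket k, Φ.zeroT) (Φ.ket k, Φ.zeroT) 1) := by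
  set u := (Φ.ket k, Φ.zeroT)
  refine ⟨?_, fun Z => ?_⟩
  · have := Matrix.posSemidef_conjTranspose_mul_self (Matrix.single u u (1 : ℂ))
    simpa using this
  have hr : (Zᴴ * Matrix.single u u (1 : ℂ) * Z).trace.re = ∑ x, ‖Z u x‖ ^ 2 := by
    simp only [Matrix.trace, Matrix.diag_apply, Complex.re_sum]
    refine Finset.sum_congr rfl fun x _ => ?_
    have : (Zᴴ * Matrix.single u u (1 : ℂ) * Z) x x = star (Z u x) * Z u x := by
      rw [Matrix.mul_apply, Finset.sum_eq_single u]
      · simp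
      · intro b _ hb; simp [hb]
      · simp
    rw [this, Complex.star_def, Complex.conj_mul', ← Complex.ofReal_pow, Complex.ofReal_re]
  have hl : ∀ s, (Zᴴ * Φ.answerBlock k 0 s).trace =
      ∑ x, if s = Φ.basisS (x, Φ.zeroL) then star (Z u x) else 0 := by
    intro s
    simp only [Matrix.trace, Matrix.diag_apply]
    refine Finset.sum_congr rfl fun x _ => ?_
    rw [Matrix.mul_apply, Finset.sum_eq_single u]
    · simp [answerBlock_zero_apply, u]
    · intro b _ hb; simp [answerBlock_zero_apply, u, hb]
    · simp
  simp_rw [hr, hl]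
  rw [← Φ.basisS.sum_comp, Fintype.sum_prod_type]
  refine Finset.sum_le_sum fun x _ => ?_
  rw [Finset.sum_eq_single Φ.zeroL]
  · simp
  · intro b _ hb; simp [hb]
  · simp

theorem exists_isDominated_answerBlock (k : Fin f) (i : ℕ) (hi : i ≤ r) :
    ∃ τ, IsDominated (Φ.answerBlock k i) τ ∧
      τ.trace = ∏ j ∈ Finset.range i, (Φ.dA (j + 1) : ℂ) ^ 2 := by
  induction i with
  | zero => exact ⟨_, Φ.isDominated_answerBlock_zero k, by simp⟩
  | succ i ih =>
    obtain ⟨τ, h, hτ⟩ := ih (by omega)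
    have h1 := (h.conj (Φ.D i)).slice
    rw [← queryBlock_eq] at h1
    have h2 := (h1.mix (Φ.E_unitary i hi).1).stack
    rw [answerBlock_succ]
    refine ⟨_, h2, ?_⟩
    rw [Matrix.trace_smul, Matrix.trace_kronecker, trace_traceLeft, Matrix.trace_mul_comm,
      ← Matrix.mul_assoc, (Φ.D_unitary i hi).1, Matrix.one_mul, hτ, Finset.prod_range_succ,
      Matrix.trace_one, smul_eq_mul, Fintype.card_fin]
    ring

/-! ### Secrecy, correctness and decoupling -/

/-- The products of the blocks of `afterQuery` with a fixed pair of basis vectors of the server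
and the query do not depend on the target index. -/
theorem Secret.queryBlock_mul {Φ : Protocol d r} (h : Φ.Secret) (k k' : Fin f) (i : ℕ) (hi : i < r)
    (p q : Fin (Φ.dS i) × Fin (Φ.dQ (i + 1))) :
    (Φ.queryBlock k i p)ᴴ * Φ.queryBlock k i q =
      (Φ.queryBlock k' i p)ᴴ * Φ.queryBlock k' i q := by
  -- The block products are the coefficients of the server's state as a linear function of `ρ`, so
  -- secrecy on product states determines them.
  have key : ∀ k ρ, Φ.serverState k i ρ q p =
      ∑ x, ∑ y, ((Φ.queryBlock k i p)ᴴ * Φ.queryBlock k i q) y x * ρ x y := by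
    intro k ρ
    simp only [serverState, traceRight, Matrix.of_apply, Matrix.mul_apply, queryBlock,
      Matrix.conjTranspose_apply, Finset.sum_mul]
    conv_rhs => rw [Finset.sum_comm]
    rw [Finset.sum_comm]
    refine Finset.sum_congr rfl fun _ _ => ?_
    rw [Finset.sum_comm]
    refine Finset.sum_congr rfl fun _ _ => Finset.sum_congr rfl fun _ _ => ?_
    ring
  have := eq_of_forall_productState
    (L := fun x y => ((Φ.queryBlock k i p)ᴴ * Φ.queryBlock k i q) y x)
    (L' := fun x y => ((Φ.queryBlock k' i p)ᴴ * Φ.queryBlock k' i q) y x) (fun ρ hρ => by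
      rw [← key, ← key, h ρ hρ k k' i hi])
  ext y x
  exact congrFun₂ this x y

/-- The server's last operation does not depend on the target index, so the independence at the last
query persists after the last answer. Without rounds the server still holds its initial state. -/
theorem Secret.answerBlock_mul {Φ : Protocol d r} (h : Φ.Secret) (k k' : Fin f)
    (s t : Fin (Φ.dS r)) :
    (Φ.answerBlock k r s)ᴴ * Φ.answerBlock k r t =
      (Φ.answerBlock k' r s)ᴴ * Φ.answerBlock k' r t := by
  rcases Nat.eq_zero_or_pos r with h0 | hr
  · subst h0
    ext x y
    have key : ∀ k, ((Φ.answerBlock k 0 s)ᴴ * Φ.answerBlock k 0 t) x y =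
        star (if s = Φ.basisS (x, Φ.zeroL) then (1 : ℂ) else 0) *
          (if t = Φ.basisS (y, Φ.zeroL) then 1 else 0) := by
      intro k
      rw [Matrix.mul_apply, Finset.sum_eq_single (Φ.ket k, Φ.zeroT)]
      · simp only [Matrix.conjTranspose_apply, answerBlock_zero_apply, if_true]
      · intro b _ hb; simp [answerBlock_zero_apply, hb]
      · simp
    rw [key, key]
  · obtain ⟨i, rfl⟩ : ∃ i, r = i + 1 := ⟨r - 1, by omega⟩
    have key : ∀ k, (Φ.answerBlock k (i + 1) s)ᴴ * Φ.answerBlock k (i + 1) t =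
        ∑ a, ∑ p, ∑ q, (star (Φ.E i (s, a) p) * Φ.E i (t, a) q) •
          ((Φ.queryBlock k i p)ᴴ * Φ.queryBlock k i q) := by
      intro k
      have h1 : ∀ a, (∑ p, Φ.E i (s, a) p • Φ.queryBlock k i p)ᴴ *
          (∑ q, Φ.E i (t, a) q • Φ.queryBlock k i q) =
          ∑ p, ∑ q, (star (Φ.E i (s, a) p) * Φ.E i (t, a) q) •
          ((Φ.queryBlock k i p)ᴴ * Φ.queryBlock k i q) := by
        intro a
        rw [Matrix.conjTranspose_sum, Matrix.sum_mul]
        refine Finset.sum_congr rfl fun p _ => ?_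
        rw [Matrix.mul_sum]
        refine Finset.sum_congr rfl fun q _ => ?_
        rw [Matrix.conjTranspose_smul, Matrix.smul_mul, Matrix.mul_smul, smul_smul]
      simp_rw [← h1]
      rw [answerBlock_succ]
      ext x y
      rw [Matrix.sum_apply, Matrix.mul_apply, Fintype.sum_prod_type]
      rfl
    rw [key, key]
    simp_rw [h.queryBlock_mul k k' i (by omega)]

/-- A correct protocol outputs message `k` on `Y`, up to an amplitude that does not depend on
message `k`. -/
theorem Correct.exists_finalBlock_update {Φ : Protocol d r} (hd : ∀ ℓ, 0 < d ℓ)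
    (h : Φ.Correct) (k : Fin f) (x : MsgBasis d) :
    ∃ c : Fin (Φ.dS r) → Fin Φ.dE → ℂ, (∀ s e y a,
      Φ.finalBlock k s (y, e) (Function.update x k a) = c s e * Φ.emb k y a) ∧
      ∑ s, ∑ e, star (c s e) * c s e = 1 := by
  have hdk' : (d k : ℂ) ≠ 0 := by exact_mod_cast (hd k).ne'
  let w : ℂ := ((Real.sqrt (d k))⁻¹ : ℝ)
  have hw : w * star w = (d k : ℂ)⁻¹ := by
    simp only [w, Complex.star_def, Complex.conj_ofReal]
    rw [← Complex.ofReal_mul, ← mul_inv, Real.mul_self_sqrt (Nat.cast_nonneg _)]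
    simp
  -- Message `k` is taken maximally entangled with its reference and the other messages are the
  -- basis states given by `x`; this one input tests the channel on all of `X_k` at once.
  let ψ : Fin (d k) × Fin (d k) → ℂ := fun p => if p.1 = p.2 then w else 0
  let ρ : (ℓ : Fin f) → Matrix (Fin (d ℓ)) (Fin (d ℓ)) ℂ := fun ℓ =>
    if ℓ = k then (d ℓ : ℂ)⁻¹ • 1 else Matrix.single (x ℓ) (x ℓ) 1
  have hρ : ∀ ℓ, IsState (ρ ℓ) := by
    intro ℓ
    by_cases hℓ : ℓ = k
    · simp only [ρ, if_pos hℓ]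
      refine ⟨Matrix.PosSemidef.one.smul (inv_nonneg.2 (Nat.cast_nonneg _)), ?_⟩
      subst hℓ
      simp [hdk']
    · simp only [ρ, if_neg hℓ]
      refine ⟨?_, by simp⟩
      have := Matrix.posSemidef_conjTranspose_mul_self (Matrix.single (x ℓ) (x ℓ) (1 : ℂ))
      simpa using this
  have hψ : IsPurification ψ (ρ k) := by
    ext a b
    simp only [traceRight, ketbra, Matrix.of_apply, ψ, ρ, if_true, Matrix.smul_apply,
      Matrix.one_apply, smul_eq_mul]
    by_cases hab : a = b
    · subst hab; simp [← hw]
    · simp [hab, apply_ite star]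
  have hin : ∀ y y' a b, purifiedInput ρ k ψ (y, a) (y', b) =
      if y = Function.update x k a then (if y' = Function.update x k b then (d k : ℂ)⁻¹ else 0)
        else 0 := by
    intro y y' a b
    simp only [purifiedInput, Matrix.of_apply, ketbra, ψ]
    have h1 : ∏ j ∈ Finset.univ.erase k, ρ j (y j) (y' j) =
        if ∀ j ∈ Finset.univ.erase k, x j = y j ∧ x j = y' j then 1 else 0 := by
      trans ∏ j ∈ Finset.univ.erase k, if x j = y j ∧ x j = y' j then (1 : ℂ) else 0
      · refine Finset.prod_congr rfl fun j hj => ?_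
        simp only [ρ, if_neg (Finset.ne_of_mem_erase hj), Matrix.single_apply]
      · rw [Finset.prod_ite_zero, Finset.prod_const_one]
        congr
    have h2 : ∀ (y : MsgBasis d) a, y = Function.update x k a ↔
        y k = a ∧ ∀ j ∈ Finset.univ.erase k, x j = y j := by
      intro y a
      rw [Function.eq_update_iff]
      simp [eq_comm]
    obtain ⟨p, hp⟩ : ∃ p : MsgBasis d → Prop,
        p = fun y => ∀ j ∈ Finset.univ.erase k, x j = y j := ⟨_, rfl⟩
    have h3 : ∀ (y : MsgBasis d) a, y = Function.update x k a ↔ y k = a ∧ p y := by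
      intro y a
      rw [h2, hp]
    have h4 : (∀ j ∈ Finset.univ.erase k, x j = y j ∧ x j = y' j) ↔ p y ∧ p y' := by
      rw [hp]
      exact forall₂_and
    classical
    rw [h1, if_congr h4 rfl rfl, if_congr (h3 y a) (if_congr (h3 y' b) rfl rfl) rfl]
    by_cases e1 : y k = a <;> by_cases e2 : y' k = b <;> by_cases e3 : p y <;>
      by_cases e4 : p y' <;> simp [e1, e2, e3, e4, ← hw]
  let v : Fin (Φ.dS r) × Fin Φ.dE → Fin Φ.dY × Fin (d k) → ℂ := fun p q =>
    Φ.finalBlock k p.1 (q.1, p.2) (Function.update x k q.2)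
  have hv : ∑ p, ketbra (v p) = ketbra (fun q => Φ.emb k q.1 q.2) := by
    have h1 := h k ρ hρ (d k) ψ hψ
    ext ⟨y, a⟩ ⟨y', b⟩
    have h2 := congrFun₂ h1 (y, a) (y', b)
    have h3 : tensorId (Φ.channel k) (purifiedInput ρ k ψ) (y, a) (y', b) =
        (d k : ℂ)⁻¹ * (∑ p, ketbra (v p)) (y, a) (y', b) := by
      simp only [tensorId, Matrix.of_apply, hin, channel, traceRight, traceLeft, Matrix.mul_apply,
        Matrix.sum_apply, ketbra, v, finalBlock]
      rw [Fintype.sum_prod_type_right, Finset.mul_sum]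
      refine Finset.sum_congr rfl fun e _ => ?_
      rw [Finset.mul_sum]
      refine Finset.sum_congr rfl fun s _ => ?_
      simp
      ring
    have h4 : ∀ y a, ((Φ.emb k ⊗ₖ (1 : Matrix (Fin (d k)) (Fin (d k)) ℂ)) *ᵥ ψ) (y, a) =
        w * Φ.emb k y a := by
      intro y a
      simp [Matrix.mulVec, dotProduct, Fintype.sum_prod_type, ψ, Matrix.one_apply, mul_comm]
    rw [h3] at h2
    simp only [ketbra, Matrix.of_apply, h4] at h2
    rw [star_mul', mul_mul_mul_comm, hw] at h2
    simpa only [ketbra, Matrix.of_apply] using mul_left_cancel₀ (inv_ne_zero hdk') h2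
  -- The output is pure, so the vector belonging to each basis pair of the server and `E` is
  -- proportional to it; the factor is the amplitude.
  choose c hc using fun p => exists_smul_of_sum_ketbra hv p
  have hc' : ∀ s e y a,
      Φ.finalBlock k s (y, e) (Function.update x k a) = c (s, e) * Φ.emb k y a :=
    fun s e y a => congrFun (hc (s, e)) (y, a)
  refine ⟨fun s e => c (s, e), hc', ?_⟩
  -- Any basis vector of `X_k` would do: the normalisation follows by comparing the diagonal entries
  -- at `(y, a)` and summing over `y`.
  let a : Fin (d k) := x k
  have hemb : ∑ y, Φ.emb k y a * star (Φ.emb k y a) = 1 := by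
    have := congrFun₂ (Φ.emb_isometry k) a a
    rw [Matrix.mul_apply, Matrix.one_apply_eq] at this
    simpa [mul_comm] using this
  have h5 : ∀ y, (∑ p, c p * star (c p)) * (Φ.emb k y a * star (Φ.emb k y a)) =
      Φ.emb k y a * star (Φ.emb k y a) := by
    intro y
    have := congrFun₂ hv (y, a) (y, a)
    simp only [hc, Matrix.sum_apply, ketbra, Matrix.of_apply, Pi.smul_apply, smul_eq_mul] at this
    refine Eq.trans ?_ this
    rw [Finset.sum_mul]
    refine Finset.sum_congr rfl fun p _ => ?_
    rw [star_mul']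
    ring
  have h6 := Finset.sum_congr rfl fun y (_ : y ∈ Finset.univ) => h5 y
  rw [← Finset.mul_sum, hemb, mul_one, Fintype.sum_prod_type] at h6
  simpa only [mul_comm] using h6

theorem finalBlock_mul (Φ : Protocol d r) (k : Fin f) (s t : Fin (Φ.dS r)) :
    (Φ.finalBlock k s)ᴴ * Φ.finalBlock k t = (Φ.answerBlock k r s)ᴴ * Φ.answerBlock k r t := by
  rw [finalBlock_eq, finalBlock_eq, Matrix.conjTranspose_mul, Matrix.mul_assoc,
    ← Matrix.mul_assoc _ Φ.Dfinal, Φ.Dfinal_unitary.1, Matrix.one_mul]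

theorem Correct.finalBlock_mul_apply_update {Φ : Protocol d r} (hd : ∀ ℓ, 0 < d ℓ)
    (h : Φ.Correct) (k : Fin f) (x : MsgBasis d) (a : Fin (d k)) (s t : Fin (Φ.dS r)) :
    ((Φ.finalBlock k s)ᴴ * Φ.finalBlock k t) (Function.update x k a) (Function.update x k a) =
      ((Φ.finalBlock k s)ᴴ * Φ.finalBlock k t) x x := by
  obtain ⟨c, hc, -⟩ := h.exists_finalBlock_update hd k x
  have key : ∀ b, ((Φ.finalBlock k s)ᴴ * Φ.finalBlock k t)
      (Function.update x k b) (Function.update x k b) = ∑ e, star (c s e) * c t e := by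
    intro b
    have hemb : ∑ y, star (Φ.emb k y b) * Φ.emb k y b = 1 := by
      have := congrFun₂ (Φ.emb_isometry k) b b
      rwa [Matrix.mul_apply, Matrix.one_apply_eq] at this
    rw [Matrix.mul_apply, Fintype.sum_prod_type_right]
    refine Finset.sum_congr rfl fun e _ => ?_
    simp only [Matrix.conjTranspose_apply, hc]
    rw [← mul_one (star (c s e) * c t e), ← hemb, Finset.mul_sum]
    refine Finset.sum_congr rfl fun y _ => ?_
    rw [star_mul']
    ring
  rw [key, ← key (x k), Function.update_eq_self]

/-- The amplitudes for `x` and `y` may differ, but the output vectors on `Y` are orthogonal because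
`emb k` is an isometry. -/
theorem Correct.finalBlock_mul_apply_of_ne {Φ : Protocol d r} (hd : ∀ ℓ, 0 < d ℓ)
    (h : Φ.Correct) (k : Fin f) (x y : MsgBasis d) (hxy : x k ≠ y k) (s t : Fin (Φ.dS r)) :
    ((Φ.finalBlock k s)ᴴ * Φ.finalBlock k t) x y = 0 := by
  obtain ⟨c, hc, -⟩ := h.exists_finalBlock_update hd k x
  obtain ⟨c', hc', -⟩ := h.exists_finalBlock_update hd k y
  have hemb : ∑ z, star (Φ.emb k z (x k)) * Φ.emb k z (y k) = 0 := by
    have := congrFun₂ (Φ.emb_isometry k) (x k) (y k)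
    rwa [Matrix.mul_apply, Matrix.one_apply_ne hxy] at this
  have h1 := fun s e z => hc s e z (x k)
  have h2 := fun s e z => hc' s e z (y k)
  simp only [Function.update_eq_self] at h1 h2
  rw [Matrix.mul_apply, Fintype.sum_prod_type_right]
  refine Finset.sum_eq_zero fun e _ => ?_
  simp only [Matrix.conjTranspose_apply, h1, h2]
  rw [← mul_zero (star (c s e) * c' t e), ← hemb, Finset.mul_sum]
  refine Finset.sum_congr rfl fun z _ => ?_
  rw [star_mul']
  ring

theorem Correct.sum_finalBlock_mul_apply {Φ : Protocol d r} (hd : ∀ ℓ, 0 < d ℓ)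
    (h : Φ.Correct) (k : Fin f) (x : MsgBasis d) :
    ∑ s, ((Φ.finalBlock k s)ᴴ * Φ.finalBlock k s) x x = 1 := by
  obtain ⟨c, hc, hc1⟩ := h.exists_finalBlock_update hd k x
  have hemb : ∑ z, star (Φ.emb k z (x k)) * Φ.emb k z (x k) = 1 := by
    have := congrFun₂ (Φ.emb_isometry k) (x k) (x k)
    rwa [Matrix.mul_apply, Matrix.one_apply_eq] at this
  have h1 := fun s e z => hc s e z (x k)
  simp only [Function.update_eq_self] at h1
  rw [← hc1]
  refine Finset.sum_congr rfl fun s _ => ?_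
  rw [Matrix.mul_apply, Fintype.sum_prod_type_right]
  refine Finset.sum_congr rfl fun e _ => ?_
  simp only [Matrix.conjTranspose_apply, h1]
  rw [← mul_one (star (c s e) * c s e), ← hemb, Finset.mul_sum]
  refine Finset.sum_congr rfl fun z _ => ?_
  rw [star_mul']
  ring

/-- At the end of a correct and secret protocol the server's system is decoupled from the
messages. -/
theorem answerBlock_mul_eq_smul {Φ : Protocol d r} (hd : ∀ ℓ, 0 < d ℓ) (hc : Φ.Correct)
    (hs : Φ.Secret) (k : Fin f) (x : MsgBasis d) (s t : Fin (Φ.dS r)) :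
    (Φ.answerBlock k r s)ᴴ * Φ.answerBlock k r t =
      ((Φ.answerBlock k r s)ᴴ * Φ.answerBlock k r t) x x • 1 := by
  set G := (Φ.answerBlock k r s)ᴴ * Φ.answerBlock k r t with hG
  -- Secrecy lets the same matrix be read as the one of any target index `l`, so correctness can be
  -- used for whichever message is convenient.
  have hGl : ∀ l, G = (Φ.finalBlock l s)ᴴ * Φ.finalBlock l t := fun l => by
    rw [finalBlock_mul, hG, hs.answerBlock_mul k l]
  have hdiag : ∀ y, G y y = G x x := by
    intro y
    -- `x` is turned into `y` one message at a time; changing message `j` uses correctness for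
    -- target `j`.
    have key : ∀ u : Finset (Fin f), G (u.piecewise y x) (u.piecewise y x) = G x x := by
      intro u
      induction u using Finset.induction_on with
      | empty => simp
      | insert j u _ ih =>
        rw [Finset.piecewise_insert, ← ih, hGl j, hc.finalBlock_mul_apply_update hd]
    simpa using key Finset.univ
  ext y z
  by_cases hyz : y = z
  · subst hyz; simp [hdiag y]
  · obtain ⟨l, hl⟩ := Function.ne_iff.1 hyz
    rw [hGl l, hc.finalBlock_mul_apply_of_ne hd l y z hl]
    simp [hyz]

/-- The answers alone are at least as large as the messages. -/
theorem prod_dim_sq_le {Φ : Protocol d r} (hd : ∀ ℓ, 0 < d ℓ) (hc : Φ.Correct)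
    (hs : Φ.Secret) (k : Fin f) :
    (∏ ℓ, (d ℓ : ℝ)) ^ 2 ≤ (∏ i ∈ Finset.range r, (Φ.dA (i + 1) : ℝ)) ^ 2 := by
  obtain ⟨τ, h, hτ⟩ := Φ.exists_isDominated_answerBlock k r le_rfl
  let x : MsgBasis d := fun ℓ => ⟨0, hd ℓ⟩
  have : Nonempty (MsgBasis d) := ⟨x⟩
  have h1 := h.card_sq_le
    (Matrix.of fun t s => ((Φ.answerBlock k r s)ᴴ * Φ.answerBlock k r t) x x)
    (fun s t => answerBlock_mul_eq_smul hd hc hs k x s t)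
    (by
      rw [← hc.sum_finalBlock_mul_apply hd k x]
      simp only [Matrix.trace, Matrix.diag_apply, Matrix.of_apply, finalBlock_mul])
  have h2 : ∏ j ∈ Finset.range r, (Φ.dA (j + 1) : ℂ) ^ 2 =
      ((∏ i ∈ Finset.range r, (Φ.dA (i + 1) : ℝ)) ^ 2 : ℝ) := by
    rw [Finset.prod_pow]
    push_cast
    rfl
  rw [hτ, h2, Complex.ofReal_re] at h1
  simpa [Fintype.card_pi] using h1

end Protocol

end QPIR

end

theorem theorem2 {f : ℕ} (d : Fin f → ℕ) (hd : ∀ ℓ, 0 < d ℓ) (r : ℕ)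
    (Φ : QPIR.Protocol d r) (hcorrect : Φ.Correct) (hsecret : Φ.Secret) :
    ∑ ℓ, Real.logb 2 (d ℓ) ≤ Φ.cost := by
  -- This includes `n = 0`, where the logarithm is `0` by convention, so the query terms can be
  -- dropped without knowing that the dimensions are positive.
  have hlog : ∀ n : ℕ, 0 ≤ Real.logb 2 (n : ℝ) := fun n =>
    div_nonneg (Real.log_natCast_nonneg n) (Real.log_nonneg one_le_two)
  have hcost : ∑ i ∈ Finset.range r, Real.logb 2 (Φ.dA (i + 1)) ≤ Φ.cost := by
    rw [QPIR.Protocol.cost, Finset.range_eq_Ico,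
      Finset.sum_Ico_add' (fun i => Real.logb 2 (Φ.dA i)) 0 r 1]
    exact Finset.sum_le_sum fun i _ => le_add_of_nonneg_left (hlog _)
  refine le_trans ?_ hcost
  -- Without messages there is no target index to run the protocol with, but the left-hand side is
  -- an empty sum.
  rcases Nat.eq_zero_or_pos f with rfl | hf
  · simpa using Finset.sum_nonneg fun i _ => hlog _
  have hpos : 0 < ∏ ℓ, (d ℓ : ℝ) := Finset.prod_pos fun ℓ _ => by exact_mod_cast hd ℓ
  have hle : ∏ ℓ, (d ℓ : ℝ) ≤ ∏ i ∈ Finset.range r, (Φ.dA (i + 1) : ℝ) :=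
    (pow_le_pow_iff_left₀ hpos.le (Finset.prod_nonneg fun _ _ => Nat.cast_nonneg _)
      two_ne_zero).1 (QPIR.Protocol.prod_dim_sq_le hd hcorrect hsecret ⟨0, hf⟩)
  rw [← Real.logb_prod _ _ fun ℓ _ => by exact_mod_cast (hd ℓ).ne',
    ← Real.logb_prod _ _ fun i hi => Finset.prod_ne_zero_iff.1 (hpos.trans_le hle).ne' i hi]
  exact Real.logb_le_logb_of_le one_lt_two hpos hle
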